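/- Let $N\ge 1$ and $M>1$ be integers, and let $[N]=\{1,\dots,N\}$ be partitioned into non-empty sets (columns) $\mathcal I_1,\dots,\mathcal I_M$. Let $$f_i(x)=A_ix+t_i,\qquad A_i=\begin{pmatrix} b_i&0\\ d_i&a_i\end{pmatrix},\qquad t_i=\begin{pmatrix}t_{i,1}\\ t_{i,2}\end{pmatrix},\qquad i\in[N],$$ be affine maps of $\mathbb R^2$ with real $d_i$, with $t_{i,1},t_{i,2}\ge 0$ and $0<a_i<b_i<1$. Suppose that there are real numbers $r_1,\dots,r_M$ and $u_1,\dots,u_M$ such that $b_i=r_k$ and $t_{i,1}=u_k$ whenever $i\in\mathcal I_k$, and that - $\sum_{j\in\mathcal I_k}a_j\le 1$ for every $k$, and $\sum_{k=1}^M r_k\le 1$; - $f_i([0,1]^2)\subset[0,1]^2$ for every $i\in[N]$; - the smallest and the largest of the fixed points of the maps $h_k(x)=r_kx+u_k$, $k=1,\dots,M$, are $0$ and $1$ respectively. (The sets $f_i([0,1]^2)$ may overlap arbitrarily, both within a column and between columns.) Let $\Lambda$ be the attractor, that is, the unique non-empty compact set with $\Lambda=\bigcup_{i=1}^N f_i(\Lambda)$;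 it is called a shifted triangular Gatzouras–Lalley-type (TGL) carpet. Let $\mathcal P$ be the set of all probability vectors $p=(p_1,\dots,p_N)$, and for $p\in\mathcal P$ put $q_k=\sum_{j\in\mathcal I_k}p_j$ and, with the convention $0\log 0=0$, $$D(p)=\frac{\sum_{i=1}^N p_i\log p_i}{\sum_{i=1}^N p_i\log a_i}+\left(1-\frac{\sum_{i=1}^N p_i\log b_i}{\sum_{i=1}^N p_i\log a_i}\right)\frac{\sum_{k=1}^M q_k\log q_k}{\sum_{i=1}^N p_i\log b_i}.$$ **Theorem.** Put $\alpha^*:=\sup_{p\in\mathcal P}D(p)$, which is finite. Then $$\dim_{\mathrm H}\Lambda\le\alpha^*.$$ Furthermore, there is $p^*\in\mathcal P$ with $p^*_i>0$ for every $i\in[N]$ and $D(p^*)=\alpha^*$. -/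

import Mathlib

open scoped Matrix

noncomputable section

namespace TGL

/-- The closed unit square `R = [0,1] × [0,1]` in the Euclidean plane. -/
def unitSquare : Set (EuclideanSpace ℝ (Fin 2)) :=
  {x | ∀ k, x k ∈ Set.Icc (0 : ℝ) 1}

/-- The data of a planar affine iterated function system `f_i(x) = A_i x + t_i`, `i ∈ Fin N`,
with lower triangular linear parts `A_i = (b_i 0; d_i a_i)`. -/
structure TriangularIFS (N : ℕ) where
  a : Fin N → ℝ
  b : Fin N → ℝ
  d : Fin N → ℝ
  t : Fin N → EuclideanSpace ℝ (Fin 2)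

namespace TriangularIFS

variable {N : ℕ} (F : TriangularIFS N)

/-- The linear part `A_i`. -/
def linearPart (i : Fin N) : Matrix (Fin 2) (Fin 2) ℝ :=
  !![F.b i, 0; F.d i, F.a i]

/-- The affine map `f_i(x) = A_i x + t_i`. -/
def map (i : Fin N) (x : EuclideanSpace ℝ (Fin 2)) : EuclideanSpace ℝ (Fin 2) :=
  WithLp.toLp 2 (F.linearPart i *ᵥ x.ofLp) + F.t i

/-- `Λ` is the attractor of the system: non-empty, compact, and `Λ = ⋃ i, f_i(Λ)`. -/
structure IsAttractor (Λ : Set (EuclideanSpace ℝ (Fin 2))) : Prop where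
  nonempty : Λ.Nonempty
  isCompact : IsCompact Λ
  eq_iUnion : Λ = ⋃ i, F.map i '' Λ

/-- The system is a *shifted* triangular Gatzouras–Lalley-type system whose columns are the fibres
of `φ : Fin N → Fin M`; column `k` has width `r k` and horizontal translation `u k`.
No separation of any kind is required, neither between nor within columns. -/
structure IsShiftedTGL {M : ℕ} (φ : Fin N → Fin M) (r u : Fin M → ℝ) : Prop where
  one_lt_columns : 1 < M
  /-- every column is non-empty -/
  surjective : Function.Surjective φ
  /-- direction-`x` dominates: `0 < a_i < b_i < 1` -/
  a_pos : ∀ i, 0 < F.a i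
  a_lt_b : ∀ i, F.a i < F.b i
  b_lt_one : ∀ i, F.b i < 1
  t_nonneg : ∀ i k, 0 ≤ F.t i k
  /-- column structure -/
  b_eq : ∀ i, F.b i = r (φ i)
  t_eq : ∀ i, F.t i 0 = u (φ i)
  sum_heights_le : ∀ k, ∑ j with φ j = k, F.a j ≤ 1
  sum_widths_le : ∑ k, r k ≤ 1
  /-- each map sends the unit square into itself -/
  image_subset : ∀ i, F.map i '' unitSquare ⊆ unitSquare
  /-- the smallest and the largest fixed points of the maps `h_k(x) = r_k x + u_k` are 0 and 1 -/
  isLeast_fixedPoint : IsLeast {x : ℝ | ∃ k, r k * x + u k = x} 0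
  isGreatest_fixedPoint : IsGreatest {x : ℝ | ∃ k, r k * x + u k = x} 1

/-- The column marginal `q_k = ∑_{φ j = k} p_j`. -/
def columnMarginal {M : ℕ} (φ : Fin N → Fin M) (p : Fin N → ℝ) (k : Fin M) : ℝ :=
  ∑ j with φ j = k, p j

/-- The function `D(p)` (with the convention `0 * log 0 = 0`). -/
def D {M : ℕ} (φ : Fin N → Fin M) (p : Fin N → ℝ) : ℝ :=
  (∑ i, p i * Real.log (p i)) / (∑ i, p i * Real.log (F.a i)) +
    (1 - (∑ i, p i * Real.log (F.b i)) / (∑ i, p i * Real.log (F.a i))) *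
      ((∑ k, columnMarginal φ p k * Real.log (columnMarginal φ p k)) /
        (∑ i, p i * Real.log (F.b i)))

/-- `α* = sup D(p)` over all probability vectors `p` on `Fin N`. -/
def alphaStar {M : ℕ} (φ : Fin N → Fin M) : ℝ :=
  sSup (F.D φ '' stdSimplex ℝ (Fin N))

end TriangularIFS

end TGL

end

/-!
For a probability vector `p` with column marginal `q`, the number `D p` equals
`(h(p) - H(q)) / χ_a(p) + H(q) / χ_b(p)`, where `h`, `H` are the entropies and `χ_a`, `χ_b` the
Lyapunov exponents `-∑ p_i log a_i`, `-∑ p_i log b_i`: a fibre dimension plus the dimension of the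
projection to the first coordinate.

*Existence and positivity of a maximizer.* `D` is continuous on the compact simplex. If a maximizer
gave mass zero to some symbol, moving mass `ε` there would raise the entropy by `ε log (1 / ε)` and
change the other terms by `O(ε)` only (`IsShiftedTGL.pos_of_isMaxOn_D`).

*The upper bound.* Code a point of `Λ` by a sequence `ω` of symbols. The first `n` symbols of `ω`
and the next `j` columns determine an approximate square, where `n + j` is the last level at which
the width `∏ b` of the cylinder is at least the height `∏ a` of the `n`-th one. Its diameter is at
most a constant times that height (`exists_dist_le`); no separation is involved. Let `S n` be the
quotient `H / χ_b` for the empirical frequencies of the first `n` columns. At the empirical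
frequencies of the first `n` symbols, `D ≤ α` bounds the fibre quotient by `α - S n`. Since `S` is
bounded, `S (n + j) > S n + ε` cannot hold for all large `n`: iterating `n ↦ n + j` would make `S`
unbounded. At each of the infinitely many other `n`, the approximate square has size to the power
`α + ε` at most the likelihood of its word under the word's own frequencies
(`exists_height_rpow_le`). Those likelihoods sum to at most the number of types, which is polynomial
in the length (`sum_typeWeight_le`), so the squares with this property cover `Λ` at every scale
with bounded sums of diameters to the power `α + 2 ε` (`hausdorffMeasure_ne_top`).
-/

namespace TGL

/-! ### Empirical frequencies -/

/-- The number of occurrences of the letter `i` among the first `n` letters of `s`. -/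
def count {ι : Type*} [DecidableEq ι] (s : ℕ → ι) (n : ℕ) (i : ι) : ℕ :=
  ((Finset.range n).filter (s · = i)).card

/-- The empirical frequency of the letter `i` among the first `n` letters of `s`; it is `0` for
`n = 0`. -/
noncomputable def freq {ι : Type*} [DecidableEq ι] (s : ℕ → ι) (n : ℕ) (i : ι) : ℝ :=
  count s n i / n

section Freq
variable {ι : Type*} [DecidableEq ι] (s : ℕ → ι) (n : ℕ)

lemma count_le (i : ι) : count s n i ≤ n := by
  simpa [count] using Finset.card_filter_le (Finset.range n) (s · = i)

lemma freq_nonneg (i : ι) : 0 ≤ freq s n i := by unfold freq; positivity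

variable {s n} in
lemma freq_pos {l : ℕ} (hl : l < n) : 0 < freq s n (s l) := by
  have : 0 < count s n (s l) :=
    Finset.card_pos.2 ⟨l, Finset.mem_filter.2 ⟨Finset.mem_range.2 hl, rfl⟩⟩
  have hn : 0 < n := by omega
  unfold freq; positivity

variable [Fintype ι]

lemma sum_freq_mul (G : ι → ℝ) :
    ∑ i, freq s n i * G i = (∑ l ∈ Finset.range n, G (s l)) / n := by
  rw [← Finset.sum_fiberwise (Finset.range n) s, Finset.sum_div]
  refine Finset.sum_congr rfl fun i _ => ?_
  rw [Finset.sum_congr rfl (g := fun _ => G i)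
    (fun l hl => by rw [(Finset.mem_filter.1 hl).2]), Finset.sum_const, nsmul_eq_mul, freq, count]
  ring

lemma sum_count : ∑ i, count s n i = n := by
  simpa [count] using (Finset.card_eq_sum_card_fiberwise (f := s) (s := Finset.range n)
    (t := Finset.univ) (fun _ _ => Finset.mem_coe.2 (Finset.mem_univ _))).symm

variable {n} in
lemma freq_mem_stdSimplex (hn : 0 < n) : freq s n ∈ stdSimplex ℝ ι := by
  refine ⟨freq_nonneg s n, ?_⟩
  have := sum_freq_mul s n (fun _ => (1 : ℝ))
  simp only [mul_one, Finset.sum_const, Finset.card_range, nsmul_eq_mul] at this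
  rw [this, div_self (by positivity)]

end Freq

namespace TriangularIFS
variable {N M : ℕ} {F : TriangularIFS N} {φ : Fin N → Fin M} {r u : Fin M → ℝ}

/-! ### The maximum of `D` -/

lemma sum_mul_log_neg {ι : Type*} [Fintype ι] {c p : ι → ℝ} (hc : ∀ i, 0 < c i)
    (hc1 : ∀ i, c i < 1) (hp : p ∈ stdSimplex ℝ ι) : ∑ i, p i * Real.log (c i) < 0 := by
  obtain ⟨i, -, hi⟩ : ∃ i ∈ Finset.univ, p i ≠ 0 := by
    apply Finset.exists_ne_zero_of_sum_ne_zero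
    rw [hp.2]; exact one_ne_zero
  refine Finset.sum_neg' (fun j _ => ?_) ⟨i, Finset.mem_univ i, ?_⟩
  · exact mul_nonpos_of_nonneg_of_nonpos (hp.1 j) (Real.log_neg (hc j) (hc1 j)).le
  · exact mul_neg_of_pos_of_neg (lt_of_le_of_ne (hp.1 i) hi.symm) (Real.log_neg (hc i) (hc1 i))

lemma IsShiftedTGL.b_pos (hF : F.IsShiftedTGL φ r u) (i : Fin N) : 0 < F.b i :=
  (hF.a_pos i).trans (hF.a_lt_b i)

lemma IsShiftedTGL.a_lt_one (hF : F.IsShiftedTGL φ r u) (i : Fin N) : F.a i < 1 :=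
  (hF.a_lt_b i).trans (hF.b_lt_one i)

lemma IsShiftedTGL.nonempty_fin (hF : F.IsShiftedTGL φ r u) : Nonempty (Fin N) :=
  let ⟨i, _⟩ := hF.surjective ⟨0, by have := hF.one_lt_columns; omega⟩
  ⟨i⟩

lemma IsShiftedTGL.continuousOn_D (hF : F.IsShiftedTGL φ r u) :
    ContinuousOn (F.D φ) (stdSimplex ℝ (Fin N)) := by
  have hlog : ∀ c : Fin N → ℝ, ContinuousOn (fun p : Fin N → ℝ => ∑ i, p i * Real.log (c i))
      (stdSimplex ℝ (Fin N)) := fun c => by fun_prop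
  have hent : Continuous (fun p : Fin N → ℝ => ∑ i, p i * Real.log (p i)) :=
    continuous_finsetSum _ fun i _ => Real.continuous_mul_log.comp (continuous_apply i)
  have hcol : Continuous (fun p : Fin N → ℝ =>
      ∑ k, columnMarginal φ p k * Real.log (columnMarginal φ p k)) := by
    refine continuous_finsetSum _ fun k _ => Real.continuous_mul_log.comp ?_
    unfold columnMarginal
    fun_prop
  have ha : ∀ p ∈ stdSimplex ℝ (Fin N), ∑ i, p i * Real.log (F.a i) ≠ 0 :=
    fun p hp => (sum_mul_log_neg hF.a_pos hF.a_lt_one hp).ne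
  have hb : ∀ p ∈ stdSimplex ℝ (Fin N), ∑ i, p i * Real.log (F.b i) ≠ 0 :=
    fun p hp => (sum_mul_log_neg hF.b_pos hF.b_lt_one hp).ne
  unfold D
  exact (hent.continuousOn.div (hlog _) ha).add ((continuousOn_const.sub
    ((hlog _).div (hlog _) ha)).mul (hcol.continuousOn.div (hlog _) hb))

/-- Convexity of `t ↦ t log t`; the term `ε * (y * log y)` is dropped, being nonpositive for
`y ∈ [0, 1]`. -/
lemma mix_mul_log_le {x y ε : ℝ} (hx : 0 ≤ x) (hy : 0 ≤ y) (hy1 : y ≤ 1) (hε : 0 ≤ ε)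
    (hε1 : ε ≤ 1) :
    ((1 - ε) * x + ε * y) * Real.log ((1 - ε) * x + ε * y) ≤ (1 - ε) * (x * Real.log x) := by
  have h := Real.convexOn_mul_log.2 (show x ∈ Set.Ici 0 from hx) (show y ∈ Set.Ici 0 from hy)
    (sub_nonneg.2 hε1) hε (by ring)
  simp only [smul_eq_mul] at h
  have h2 : ε * (y * Real.log y) ≤ 0 :=
    mul_nonpos_of_nonneg_of_nonpos hε (Real.mul_log_nonpos hy hy1)
  linarith

/-- A maximizer of `D` charges every symbol: moving mass `ε` onto a symbol of mass zero gains
entropy of order `ε log (1 / ε)`, while everything else changes by `O(ε)`. -/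
lemma IsShiftedTGL.pos_of_isMaxOn_D (hF : F.IsShiftedTGL φ r u) {p : Fin N → ℝ}
    (hp : p ∈ stdSimplex ℝ (Fin N)) (hmax : IsMaxOn (F.D φ) (stdSimplex ℝ (Fin N)) p)
    (i : Fin N) : 0 < p i := by
  refine lt_of_le_of_ne (hp.1 i) fun hi => ?_
  set e : Fin N → ℝ := Pi.single i 1 with he
  have heS : e ∈ stdSimplex ℝ (Fin N) := single_mem_stdSimplex ℝ i
  have hmix : ∀ ε : ℝ, 0 ≤ ε → ε ≤ 1 → (fun j => (1 - ε) * p j + ε * e j) ∈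
      stdSimplex ℝ (Fin N) := fun ε h0 h1 =>
    convex_stdSimplex ℝ (Fin N) hp heS (sub_nonneg.2 h1) h0 (by ring)
  set la := ∑ j, p j * Real.log (F.a j) with hla
  set lb := ∑ j, p j * Real.log (F.b j) with hlb
  set h := ∑ j, p j * Real.log (p j) with hh
  set H := ∑ k, columnMarginal φ p k * Real.log (columnMarginal φ p k) with hH
  have hsum : ∀ (c : Fin N → ℝ) (ε : ℝ), ∑ j, ((1 - ε) * p j + ε * e j) * Real.log (c j) =
      (1 - ε) * ∑ j, p j * Real.log (c j) + ε * Real.log (c i) := by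
    intro c ε
    simp only [add_mul, Finset.sum_add_distrib, mul_assoc, ← Finset.mul_sum]
    congr 2
    rw [Finset.sum_eq_single i] <;> simp +contextual [he]
  have hcolmix : ∀ (ε : ℝ) (k : Fin M), columnMarginal φ (fun j => (1 - ε) * p j + ε * e j) k =
      (1 - ε) * columnMarginal φ p k + ε * columnMarginal φ e k := by
    intro ε k
    simp only [columnMarginal, Finset.sum_add_distrib, ← Finset.mul_sum]
  have hcol_nonneg : ∀ q ∈ stdSimplex ℝ (Fin N), ∀ k, 0 ≤ columnMarginal φ q k :=
    fun q hq k => Finset.sum_nonneg fun j _ => hq.1 j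
  have hcol_le : ∀ q ∈ stdSimplex ℝ (Fin N), ∀ k, columnMarginal φ q k ≤ 1 := by
    intro q hq k
    rw [← hq.2]
    exact Finset.sum_le_univ_sum_of_nonneg hq.1
  have hHε : ∀ ε : ℝ, 0 ≤ ε → ε ≤ 1 →
      ∑ k, columnMarginal φ (fun j => (1 - ε) * p j + ε * e j) k *
        Real.log (columnMarginal φ (fun j => (1 - ε) * p j + ε * e j) k) ≤ (1 - ε) * H := by
    intro ε h0 h1
    rw [hH, Finset.mul_sum]
    refine Finset.sum_le_sum fun k _ => ?_
    rw [hcolmix]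
    exact mix_mul_log_le (hcol_nonneg p hp k) (hcol_nonneg e heS k) (hcol_le e heS k) h0 h1
  have hhε : ∀ ε : ℝ, 0 ≤ ε → ε ≤ 1 →
      ∑ j, ((1 - ε) * p j + ε * e j) * Real.log ((1 - ε) * p j + ε * e j) ≤
        (1 - ε) * h + ε * Real.log ε := by
    intro ε h0 h1
    have hs : ε * Real.log ε = ∑ j, if j = i then ε * Real.log ε else 0 := by simp
    rw [hh, Finset.mul_sum, hs, ← Finset.sum_add_distrib]
    refine Finset.sum_le_sum fun j _ => ?_
    by_cases hj : j = i
    · subst hj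
      simp [he, ← hi]
    · have := mix_mul_log_le (hp.1 j) le_rfl zero_le_one h0 h1
      simpa [he, Pi.single_apply, hj] using this
  have hla0 : la < 0 := sum_mul_log_neg hF.a_pos hF.a_lt_one hp
  have hlb0 : lb < 0 := sum_mul_log_neg hF.b_pos hF.b_lt_one hp
  have hA0 : Real.log (F.a i) < 0 := Real.log_neg (hF.a_pos i) (hF.a_lt_one i)
  have hB0 : Real.log (F.b i) < 0 := Real.log_neg (hF.b_pos i) (hF.b_lt_one i)
  set A := Real.log (F.a i)
  set B := Real.log (F.b i)
  -- `-m` is a lower bound for the exponent `χ_b` along the whole segment from `p` to `e`.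
  set m := max lb B with hm
  have hm0 : m < 0 := max_lt hlb0 hB0
  set α := F.D φ p with hα
  have hα_eq : h * lb + (la - lb) * H = α * la * lb := by
    rw [hα, D]
    simp only [← hla, ← hlb, ← hh, ← hH]
    have := hla0.ne
    have := hlb0.ne
    field_simp
  -- Clear denominators in `D (p_ε) ≤ D p`; both sides agree at `ε = 0`, so dividing
  -- by `ε` bounds `log (1 / ε)`.
  have key : ∀ ε : ℝ, 0 < ε → ε ≤ 1 → -Real.log ε * -m ≤
      |α * (la * (B - lb) + (A - la) * lb) - (h * (B - lb) + ((A - la) - (B - lb)) * H)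
        + (h * lb + (la - lb) * H)| +
      |α * (A - la) * (B - lb) + (h * (B - lb) + ((A - la) - (B - lb)) * H)| := by
    intro ε h0 h1
    have hle := hmax (hmix ε h0.le h1)
    have hpa := sum_mul_log_neg hF.a_pos hF.a_lt_one (hmix ε h0.le h1)
    have hpb := sum_mul_log_neg hF.b_pos hF.b_lt_one (hmix ε h0.le h1)
    have hpab : ∑ j, ((1 - ε) * p j + ε * e j) * Real.log (F.a j) ≤
        ∑ j, ((1 - ε) * p j + ε * e j) * Real.log (F.b j) :=
      Finset.sum_le_sum fun j _ => mul_le_mul_of_nonneg_left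
        (Real.log_le_log (hF.a_pos j) (hF.a_lt_b j).le) ((hmix ε h0.le h1).1 j)
    have e1 := hhε ε h0.le h1
    have e2 := hHε ε h0.le h1
    change D F φ _ ≤ α at hle
    rw [D] at hle
    simp only [hsum F.a ε, hsum F.b ε, ← hla, ← hlb] at hpa hpb hle hpab
    set la' := (1 - ε) * la + ε * A with hla'
    set lb' := (1 - ε) * lb + ε * B with hlb'
    set h' := ∑ j, ((1 - ε) * p j + ε * e j) * Real.log ((1 - ε) * p j + ε * e j)
    set H' := ∑ k, columnMarginal φ (fun j => (1 - ε) * p j + ε * e j) k *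
        Real.log (columnMarginal φ (fun j => (1 - ε) * p j + ε * e j) k)
    have hle' : h' * lb' + (la' - lb') * H' ≤ α * la' * lb' := by
      have : h' / la' + (1 - lb' / la') * (H' / lb') =
          (h' * lb' + (la' - lb') * H') / (la' * lb') := by
        have := hpa.ne
        have := hpb.ne
        field_simp
      rw [this, div_le_iff₀ (mul_pos_of_neg_of_neg hpa hpb)] at hle
      linarith
    have hm' : lb' ≤ m := by
      have h3 : (1 - ε) * lb ≤ (1 - ε) * m :=
        mul_le_mul_of_nonneg_left (le_max_left _ _) (sub_nonneg.2 h1)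
      have h4 : ε * B ≤ ε * m := mul_le_mul_of_nonneg_left (le_max_right _ _) h0.le
      rw [hlb']; linarith
    have e3 := mul_le_mul_of_nonpos_right e1 hpb.le
    have e4 := mul_le_mul_of_nonpos_left e2 (sub_nonpos.2 hpab)
    have hlogε : Real.log ε ≤ 0 := Real.log_nonpos h0.le h1
    have e5 : ε * (Real.log ε * m) ≤ ε * (Real.log ε * lb') :=
      mul_le_mul_of_nonneg_left (mul_le_mul_of_nonpos_left hm' hlogε) h0.le
    set K0 := α * (la * (B - lb) + (A - la) * lb) - (h * (B - lb) + ((A - la) - (B - lb)) * H)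
        + (h * lb + (la - lb) * H) with hK0
    set K1 := α * (A - la) * (B - lb) + (h * (B - lb) + ((A - la) - (B - lb)) * H) with hK1
    have e6 : ε * (Real.log ε * m) ≤ ε * (K0 + ε * K1) := by
      have : ε * (K0 + ε * K1) = α * la' * lb' - (1 - ε) * h * lb' - (la' - lb') * ((1 - ε) * H)
          + ((h * lb + (la - lb) * H) - α * la * lb) := by
        rw [hK0, hK1, hla', hlb']; ring
      rw [this]
      linarith
    have e7 := le_of_mul_le_mul_left e6 h0
    have e8 : ε * K1 ≤ |K1| := by
      calc ε * K1 ≤ ε * |K1| := mul_le_mul_of_nonneg_left (le_abs_self _) h0.le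
        _ ≤ 1 * |K1| := mul_le_mul_of_nonneg_right h1 (abs_nonneg _)
        _ = |K1| := one_mul _
    linarith [le_abs_self K0]
  set K := |α * (la * (B - lb) + (A - la) * lb) - (h * (B - lb) + ((A - la) - (B - lb)) * H)
        + (h * lb + (la - lb) * H)| +
      |α * (A - la) * (B - lb) + (h * (B - lb) + ((A - la) - (B - lb)) * H)| with hK
  have hK0 : 0 ≤ K := by positivity
  have hKm : 0 ≤ K / -m := div_nonneg hK0 (by linarith)
  -- An `ε` so small that `log (1 / ε)` exceeds the bound `K / -m`.
  have := key (Real.exp (-(K / -m + 1))) (Real.exp_pos _)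
    (Real.exp_le_one_iff.2 (by linarith))
  rw [Real.log_exp, neg_neg, add_mul, div_mul_cancel₀ _ (by linarith)] at this
  linarith

lemma IsShiftedTGL.exists_isMaxOn_D (hF : F.IsShiftedTGL φ r u) :
    ∃ p ∈ stdSimplex ℝ (Fin N), IsMaxOn (F.D φ) (stdSimplex ℝ (Fin N)) p := by
  obtain ⟨i⟩ := hF.nonempty_fin
  exact (isCompact_stdSimplex ℝ (Fin N)).exists_isMaxOn ⟨_, single_mem_stdSimplex ℝ i⟩
    hF.continuousOn_D

lemma IsShiftedTGL.bddAbove_D (hF : F.IsShiftedTGL φ r u) :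
    BddAbove (F.D φ '' stdSimplex ℝ (Fin N)) :=
  (isCompact_stdSimplex ℝ (Fin N)).bddAbove_image hF.continuousOn_D

/-! ### Likelihoods and the number of types -/

lemma columnMarginal_freq (ω : ℕ → Fin N) (n : ℕ) (k : Fin M) :
    columnMarginal φ (freq ω n) k = freq (φ ∘ ω) n k := by
  have := sum_freq_mul ω n (fun i => if φ i = k then (1 : ℝ) else 0)
  rw [columnMarginal, Finset.sum_filter]
  simpa [freq, count] using this

/-- The conditional weight of `i` in its column, for a vector of masses `c`; it is `0` in a column
without mass. -/
noncomputable def condWeight (φ : Fin N → Fin M) (c : Fin N → ℝ) (i : Fin N) : ℝ :=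
  c i / columnMarginal φ c (φ i)

lemma condWeight_nonneg {c : Fin N → ℝ} (hc : ∀ i, 0 ≤ c i) (i : Fin N) :
    0 ≤ condWeight φ c i :=
  div_nonneg (hc i) (Finset.sum_nonneg fun j _ => hc j)

lemma sum_condWeight_le (c : Fin N → ℝ) (k : Fin M) :
    ∑ i with φ i = k, condWeight φ c i ≤ 1 := by
  have : ∑ i with φ i = k, condWeight φ c i = (∑ i with φ i = k, c i) / columnMarginal φ c k := by
    rw [Finset.sum_div]
    refine Finset.sum_congr rfl fun i hi => ?_
    rw [condWeight, (Finset.mem_filter.1 hi).2]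
  rw [this]
  exact div_self_le_one _

lemma condWeight_count {ω : ℕ → Fin N} {n : ℕ} (hn : 0 < n) (i : Fin N) :
    condWeight φ (fun j => (count ω n j : ℝ)) i = freq ω n i / freq (φ ∘ ω) n (φ i) := by
  have hn' : (n : ℝ) ≠ 0 := by positivity
  rw [← columnMarginal_freq, condWeight, columnMarginal, columnMarginal]
  simp only [freq, ← Finset.sum_div]
  field_simp

/-- The product weight of a word of `n` symbols followed by `j` columns: a symbol `i` of column `k`
has weight `g i * h k`, a column `k` has weight `h k`. -/
noncomputable def wordWeight (φ : Fin N → Fin M) (g : Fin N → ℝ) (h : Fin M → ℝ) {n j : ℕ}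
    (w : (Fin n → Fin N) × (Fin j → Fin M)) : ℝ :=
  (∏ l, g (w.1 l) * h (φ (w.1 l))) * ∏ l, h (w.2 l)

lemma wordWeight_nonneg {g : Fin N → ℝ} {h : Fin M → ℝ} (hg : ∀ i, 0 ≤ g i) (hh : ∀ k, 0 ≤ h k)
    {n j : ℕ} (w : (Fin n → Fin N) × (Fin j → Fin M)) : 0 ≤ wordWeight φ g h w :=
  mul_nonneg (Finset.prod_nonneg fun _ _ => mul_nonneg (hg _) (hh _))
    (Finset.prod_nonneg fun _ _ => hh _)

/-- If `g` has mass at most one in every column and `h` has total mass at most one, the word weights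
form a subprobability: the sum factors into `(∑ g i * h (φ i)) ^ n * (∑ h k) ^ j`. -/
lemma sum_wordWeight_le {g : Fin N → ℝ} {h : Fin M → ℝ} (hg : ∀ i, 0 ≤ g i) (hh : ∀ k, 0 ≤ h k)
    (hg1 : ∀ k, ∑ i with φ i = k, g i ≤ 1) (hh1 : ∑ k, h k ≤ 1) (n j : ℕ) :
    ∑ w : (Fin n → Fin N) × (Fin j → Fin M), wordWeight φ g h w ≤ 1 := by
  simp only [wordWeight]
  rw [Fintype.sum_prod_type]
  simp only [← Finset.mul_sum, ← Finset.sum_mul]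
  rw [← Fintype.sum_pow (fun i => g i * h (φ i)), ← Fintype.sum_pow h]
  have h1 : ∑ i, g i * h (φ i) ≤ 1 := by
    rw [← Finset.sum_fiberwise Finset.univ φ]
    refine le_trans (Finset.sum_le_sum fun k _ => ?_) hh1
    rw [Finset.sum_congr rfl (g := fun i => g i * h k)
      (fun i hi => by rw [(Finset.mem_filter.1 hi).2]), ← Finset.sum_mul]
    exact mul_le_of_le_one_left (hh k) (hg1 k)
  have h0 : 0 ≤ ∑ i, g i * h (φ i) := Finset.sum_nonneg fun i _ => mul_nonneg (hg i) (hh _)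
  exact mul_le_one₀ (pow_le_one₀ h0 h1) (pow_nonneg (Finset.sum_nonneg fun k _ => hh k) _)
    (pow_le_one₀ (Finset.sum_nonneg fun k _ => hh k) hh1)

/-- The weight of a word of `n` symbols followed by `j` columns under the probabilities obtained
from a vector `c` of symbol counts (inside the columns) and a vector `e` of column counts. -/
noncomputable def countWeight (φ : Fin N → Fin M) (c : Fin N → ℕ) (e : Fin M → ℕ) {n j : ℕ}
    (w : (Fin n → Fin N) × (Fin j → Fin M)) : ℝ :=
  wordWeight φ (condWeight φ fun i => (c i : ℝ)) (fun k => (e k : ℝ) / ∑ k, (e k : ℝ)) w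

lemma countWeight_nonneg (c : Fin N → ℕ) (e : Fin M → ℕ) {n j : ℕ}
    (w : (Fin n → Fin N) × (Fin j → Fin M)) : 0 ≤ countWeight φ c e w :=
  wordWeight_nonneg (condWeight_nonneg fun i => by positivity) (fun k => by positivity) w

/-- The sum of `countWeight` over all types, that is, over all count vectors that are possible for
words of `n` symbols and of `n + j` columns. -/
noncomputable def typeWeight (φ : Fin N → Fin M) {n j : ℕ}
    (w : (Fin n → Fin N) × (Fin j → Fin M)) : ℝ :=
  ∑ c : Fin N → Fin (n + 1), ∑ e : Fin M → Fin (n + j + 1),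
    countWeight φ (fun i => c i) (fun k => e k) w

/-- Each type contributes total weight at most one, and there are only polynomially many types. -/
lemma sum_typeWeight_le (φ : Fin N → Fin M) (n j : ℕ) :
    ∑ w : (Fin n → Fin N) × (Fin j → Fin M), typeWeight φ w ≤
      (n + 1 : ℝ) ^ N * (n + j + 1 : ℝ) ^ M := by
  simp only [typeWeight]
  rw [Finset.sum_comm]
  calc _ ≤ ∑ c : Fin N → Fin (n + 1), ∑ e : Fin M → Fin (n + j + 1), (1 : ℝ) := by
        refine Finset.sum_le_sum fun c _ => ?_
        rw [Finset.sum_comm]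
        refine Finset.sum_le_sum fun e _ => ?_
        refine sum_wordWeight_le (condWeight_nonneg fun i => by positivity)
          (fun k => by positivity) (sum_condWeight_le _) ?_ n j
        rw [← Finset.sum_div]
        exact div_self_le_one _
    _ = _ := by simp

lemma typeWeight_nonneg {n j : ℕ} (w : (Fin n → Fin N) × (Fin j → Fin M)) :
    0 ≤ typeWeight φ w :=
  Finset.sum_nonneg fun _ _ => Finset.sum_nonneg fun _ _ => countWeight_nonneg _ _ w

/-! ### Products along a sequence of symbols -/

/-- The height `∏_{l < n} a_{ω l}` of the `n`-th cylinder along `ω`. -/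
noncomputable def height (F : TriangularIFS N) (ω : ℕ → Fin N) (n : ℕ) : ℝ :=
  ∏ l ∈ Finset.range n, F.a (ω l)

/-- The width `∏_{l < n} b_{ω l}` of the `n`-th cylinder along `ω`. -/
noncomputable def width (F : TriangularIFS N) (ω : ℕ → Fin N) (n : ℕ) : ℝ :=
  ∏ l ∈ Finset.range n, F.b (ω l)

/-- The conditional likelihood, given its column word, of the first `n` letters of `ω` under their
own empirical frequencies. -/
noncomputable def fibreLikelihood (φ : Fin N → Fin M) (ω : ℕ → Fin N) (n : ℕ) : ℝ :=
  ∏ l ∈ Finset.range n, freq ω n (ω l) / freq (φ ∘ ω) n (φ (ω l))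

/-- The likelihood of the first `n` columns of `ω` under their own empirical frequencies. -/
noncomputable def columnLikelihood (φ : Fin N → Fin M) (ω : ℕ → Fin N) (n : ℕ) : ℝ :=
  ∏ l ∈ Finset.range n, freq (φ ∘ ω) n (φ (ω l))

lemma fibreLikelihood_pos (ω : ℕ → Fin N) (n : ℕ) : 0 < fibreLikelihood φ ω n :=
  Finset.prod_pos fun _ hl => div_pos (freq_pos (Finset.mem_range.1 hl))
    (freq_pos (s := φ ∘ ω) (Finset.mem_range.1 hl))

lemma columnLikelihood_pos (ω : ℕ → Fin N) (n : ℕ) : 0 < columnLikelihood φ ω n :=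
  Finset.prod_pos fun _ hl => freq_pos (s := φ ∘ ω) (Finset.mem_range.1 hl)

lemma fibreLikelihood_le_one (ω : ℕ → Fin N) (n : ℕ) : fibreLikelihood φ ω n ≤ 1 := by
  refine Finset.prod_le_one (fun l _ => div_nonneg (freq_nonneg _ _ _) (freq_nonneg _ _ _))
    fun l hl => ?_
  refine div_le_one_of_le₀ ?_ (freq_nonneg _ _ _)
  rw [← columnMarginal_freq, columnMarginal]
  exact Finset.single_le_sum (f := freq ω n) (fun i _ => freq_nonneg _ _ _) (by simp)

lemma columnLikelihood_le_one (ω : ℕ → Fin N) (n : ℕ) : columnLikelihood φ ω n ≤ 1 := by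
  refine Finset.prod_le_one (fun l _ => freq_nonneg _ _ _) fun l hl => ?_
  have hn : 0 < n := by have := Finset.mem_range.1 hl; omega
  have h := freq_mem_stdSimplex (φ ∘ ω) hn
  rw [← h.2]
  exact Finset.single_le_sum (f := freq (φ ∘ ω) n) (fun i _ => h.1 i) (Finset.mem_univ _)

/-- The likelihoods along `ω` are dominated by the weight summed over all types, since the counts
of `ω` are one of the types. -/
lemma likelihood_le_typeWeight {ω : ℕ → Fin N} {n j : ℕ} (hn : 0 < n)
    {w : (Fin n → Fin N) × (Fin j → Fin M)} (hw1 : ∀ l : Fin n, ω l = w.1 l)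
    (hw2 : ∀ l : Fin j, φ (ω (n + l)) = w.2 l) :
    fibreLikelihood φ ω n * columnLikelihood φ ω (n + j) ≤ typeWeight φ w := by
  have heq : fibreLikelihood φ ω n * columnLikelihood φ ω (n + j) =
      countWeight φ (count ω n) (count (φ ∘ ω) (n + j)) w := by
    have hsum : ∑ k, (count (φ ∘ ω) (n + j) k : ℝ) = ((n + j : ℕ) : ℝ) := by
      exact_mod_cast sum_count (φ ∘ ω) (n + j)
    rw [countWeight, wordWeight, hsum, fibreLikelihood, columnLikelihood, Finset.prod_range_add,
      ← mul_assoc, ← Finset.prod_mul_distrib, Finset.prod_range, Finset.prod_range]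
    congr 1
    · refine Finset.prod_congr rfl fun l _ => ?_
      rw [hw1, condWeight_count hn]; rfl
    · refine Finset.prod_congr rfl fun l _ => ?_
      rw [hw2]; rfl
  rw [heq]
  let c : Fin N → Fin (n + 1) := fun i => ⟨count ω n i, Nat.lt_succ_of_le (count_le _ _ _)⟩
  let e : Fin M → Fin (n + j + 1) :=
    fun k => ⟨count (φ ∘ ω) (n + j) k, Nat.lt_succ_of_le (count_le _ _ _)⟩
  calc countWeight φ (count ω n) (count (φ ∘ ω) (n + j)) w
      = countWeight φ (fun i => c i) (fun k => e k) w := rfl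
    _ ≤ ∑ e : Fin M → Fin (n + j + 1), countWeight φ (fun i => c i) (fun k => e k) w :=
        Finset.single_le_sum (f := fun e : Fin M → Fin (n + j + 1) =>
          countWeight φ (fun i => c i) (fun k => e k) w)
          (fun _ _ => countWeight_nonneg _ _ w) (Finset.mem_univ e)
    _ ≤ typeWeight φ w :=
        Finset.single_le_sum (f := fun c : Fin N → Fin (n + 1) => ∑ e : Fin M → Fin (n + j + 1),
          countWeight φ (fun i => c i) (fun k => e k) w)
          (fun _ _ => Finset.sum_nonneg fun _ _ => countWeight_nonneg _ _ w) (Finset.mem_univ c)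

lemma log_height (hF : F.IsShiftedTGL φ r u) (ω : ℕ → Fin N) (n : ℕ) :
    Real.log (F.height ω n) = ∑ l ∈ Finset.range n, Real.log (F.a (ω l)) :=
  Real.log_prod fun _ _ => (hF.a_pos _).ne'

lemma log_width (hF : F.IsShiftedTGL φ r u) (ω : ℕ → Fin N) (n : ℕ) :
    Real.log (F.width ω n) = ∑ l ∈ Finset.range n, Real.log (F.b (ω l)) :=
  Real.log_prod fun _ _ => (hF.b_pos _).ne'

lemma height_pos (hF : F.IsShiftedTGL φ r u) (ω : ℕ → Fin N) (n : ℕ) : 0 < F.height ω n :=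
  Finset.prod_pos fun _ _ => hF.a_pos _

lemma width_pos (hF : F.IsShiftedTGL φ r u) (ω : ℕ → Fin N) (n : ℕ) : 0 < F.width ω n :=
  Finset.prod_pos fun _ _ => hF.b_pos _

lemma height_le_width (hF : F.IsShiftedTGL φ r u) (ω : ℕ → Fin N) (n : ℕ) :
    F.height ω n ≤ F.width ω n :=
  Finset.prod_le_prod (fun _ _ => (hF.a_pos _).le) fun _ _ => (hF.a_lt_b _).le

lemma log_width_neg (hF : F.IsShiftedTGL φ r u) (ω : ℕ → Fin N) {n : ℕ} (hn : 0 < n) :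
    Real.log (F.width ω n) < 0 := by
  rw [log_width hF]
  exact Finset.sum_neg (fun l _ => Real.log_neg (hF.b_pos _) (hF.b_lt_one _))
    (Finset.nonempty_range_iff.2 hn.ne')

lemma log_height_neg (hF : F.IsShiftedTGL φ r u) (ω : ℕ → Fin N) {n : ℕ} (hn : 0 < n) :
    Real.log (F.height ω n) < 0 :=
  (Real.log_le_log (height_pos hF ω n) (height_le_width hF ω n)).trans_lt (log_width_neg hF ω hn)

/-- At the empirical frequencies of `ω`, the number `D` is the sum of the dimension of the fibre
and of the dimension of the projection to the first coordinate. -/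
lemma D_freq (hF : F.IsShiftedTGL φ r u) (ω : ℕ → Fin N) {n : ℕ} (hn : 0 < n) :
    F.D φ (freq ω n) = Real.log (fibreLikelihood φ ω n) / Real.log (F.height ω n) +
      Real.log (columnLikelihood φ ω n) / Real.log (F.width ω n) := by
  have hn' : (n : ℝ) ≠ 0 := by positivity
  have hA := (log_height_neg hF ω hn).ne
  have hB := (log_width_neg hF ω hn).ne
  have hV : Real.log (columnLikelihood φ ω n) =
      ∑ l ∈ Finset.range n, Real.log (freq (φ ∘ ω) n (φ (ω l))) :=
    Real.log_prod fun l hl => (freq_pos (s := φ ∘ ω) (Finset.mem_range.1 hl)).ne'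
  have hU : Real.log (fibreLikelihood φ ω n) =
      ∑ l ∈ Finset.range n, Real.log (freq ω n (ω l)) - Real.log (columnLikelihood φ ω n) := by
    rw [hV, ← Finset.sum_sub_distrib, fibreLikelihood, Real.log_prod]
    · refine Finset.sum_congr rfl fun l hl => ?_
      exact Real.log_div (freq_pos (Finset.mem_range.1 hl)).ne'
        (freq_pos (s := φ ∘ ω) (Finset.mem_range.1 hl)).ne'
    · exact fun l hl => (div_pos (freq_pos (Finset.mem_range.1 hl))
        (freq_pos (s := φ ∘ ω) (Finset.mem_range.1 hl))).ne'
  have hcol : ∑ k, freq (φ ∘ ω) n k * Real.log (freq (φ ∘ ω) n k) =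
      Real.log (columnLikelihood φ ω n) / n := by
    rw [hV, sum_freq_mul (φ ∘ ω) n (fun k => Real.log (freq (φ ∘ ω) n k))]; rfl
  rw [D]
  simp only [columnMarginal_freq]
  rw [hcol, sum_freq_mul ω n (fun i => Real.log (freq ω n i)),
    sum_freq_mul ω n (fun i => Real.log (F.a i)), sum_freq_mul ω n (fun i => Real.log (F.b i)),
    ← log_height hF, ← log_width hF, hU]
  field_simp
  ring

/-! ### Scales at which the projection entropy does not grow -/

lemma width_antitone (hF : F.IsShiftedTGL φ r u) (ω : ℕ → Fin N) : Antitone (F.width ω) := by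
  refine antitone_nat_of_succ_le fun n => ?_
  rw [width, Finset.prod_range_succ]
  exact mul_le_of_le_one_right (width_pos hF ω n).le (hF.b_lt_one _).le

lemma IsShiftedTGL.exists_b_le (hF : F.IsShiftedTGL φ r u) :
    ∃ β : ℝ, 0 < β ∧ β < 1 ∧ ∀ i, F.b i ≤ β := by
  have := hF.nonempty_fin
  obtain ⟨i, hi⟩ := Finite.exists_max F.b
  exact ⟨F.b i, hF.b_pos i, hF.b_lt_one i, hi⟩

lemma width_le_pow (hF : F.IsShiftedTGL φ r u) {β : ℝ} (hβ : ∀ i, F.b i ≤ β) (ω : ℕ → Fin N)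
    (n : ℕ) : F.width ω n ≤ β ^ n := by
  calc F.width ω n ≤ ∏ _l ∈ Finset.range n, β :=
        Finset.prod_le_prod (fun _ _ => (hF.b_pos _).le) fun _ _ => hβ _
    _ = β ^ n := by simp

/-- The last level at which the width of the cylinder still is at least the height of the `n`-th
cylinder. -/
lemma exists_width_lt_height_le (hF : F.IsShiftedTGL φ r u) (ω : ℕ → Fin N) (n : ℕ) :
    ∃ j, F.height ω n ≤ F.width ω (n + j) ∧ F.width ω (n + j + 1) < F.height ω n := by
  obtain ⟨β, hβ0, hβ1, hβ⟩ := hF.exists_b_le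
  have hex : ∃ j, F.width ω (n + j + 1) < F.height ω n := by
    obtain ⟨m, hm⟩ := exists_pow_lt_of_lt_one (height_pos hF ω n) hβ1
    refine ⟨m, lt_of_le_of_lt (width_antitone hF ω (by omega : m ≤ n + m + 1)) ?_⟩
    exact (width_le_pow hF hβ ω m).trans_lt hm
  classical
  refine ⟨Nat.find hex, ?_, Nat.find_spec hex⟩
  rcases h : Nat.find hex with _ | j
  · exact height_le_width hF ω n
  · exact not_lt.1 (Nat.find_min hex (by omega : j < Nat.find hex))

/-- If `D` is at most `α`, then along every sequence there are arbitrarily large `n` for which the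
likelihoods of the approximate square of level `n` are at least its size to the power `α + ε`.
Otherwise the entropy quotient of the columns would grow by `ε` at each step of the iteration
`n ↦ n + j`, although it is bounded by `α`. -/
lemma exists_height_rpow_le (hF : F.IsShiftedTGL φ r u) {α ε : ℝ} (hε : 0 < ε)
    (hα : ∀ p ∈ stdSimplex ℝ (Fin N), F.D φ p ≤ α) (ω : ℕ → Fin N) (n₀ : ℕ) :
    ∃ n j, n₀ < n ∧ F.height ω n ≤ F.width ω (n + j) ∧ F.width ω (n + j + 1) < F.height ω n ∧
      F.height ω n ^ (α + ε) ≤ fibreLikelihood φ ω n * columnLikelihood φ ω (n + j) := by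
  choose J hJ1 hJ2 using exists_width_lt_height_le hF ω
  set S : ℕ → ℝ := fun n => Real.log (columnLikelihood φ ω n) / Real.log (F.width ω n) with hS
  have hS0 : ∀ n, 0 < n → 0 ≤ S n := fun n hn => div_nonneg_of_nonpos
    (Real.log_nonpos (columnLikelihood_pos ω n).le (columnLikelihood_le_one ω n))
    (log_width_neg hF ω hn).le
  have hDα : ∀ n, 0 < n →
      Real.log (fibreLikelihood φ ω n) / Real.log (F.height ω n) + S n ≤ α := by
    intro n hn
    rw [hS, ← D_freq hF ω hn]
    exact hα _ (freq_mem_stdSimplex ω hn)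
  have hSα : ∀ n, 0 < n → S n ≤ α := by
    intro n hn
    have : 0 ≤ Real.log (fibreLikelihood φ ω n) / Real.log (F.height ω n) :=
      div_nonneg_of_nonpos (Real.log_nonpos (fibreLikelihood_pos ω n).le
        (fibreLikelihood_le_one ω n)) (log_height_neg hF ω hn).le
    linarith [hDα n hn]
  obtain ⟨n, hn, hSn⟩ : ∃ n, n₀ < n ∧ S (n + J n) ≤ S n + ε := by
    by_contra! hcon
    let it : ℕ → ℕ := fun i => (fun n => n + J n)^[i] (n₀ + 1)
    have hit_succ : ∀ i, it (i + 1) = it i + J (it i) := fun i =>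
      Function.iterate_succ_apply' _ _ _
    have hit : ∀ i, n₀ < it i := by
      intro i
      induction i with
      | zero => exact Nat.lt_succ_self n₀
      | succ i ih => rw [hit_succ]; omega
    have hgrow : ∀ i : ℕ, i * ε ≤ S (it i) := by
      intro i
      induction i with
      | zero => simpa using hS0 _ (Nat.zero_lt_of_lt (hit 0))
      | succ i ih =>
        have := hcon (it i) (hit i)
        rw [hit_succ]
        push_cast
        linarith
    obtain ⟨i, hi⟩ := exists_nat_gt (α / ε)
    rw [div_lt_iff₀ hε] at hi
    linarith [hgrow i, hSα _ (Nat.zero_lt_of_lt (hit i))]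
  have hn0 : 0 < n := by omega
  refine ⟨n, J n, hn, hJ1 n, hJ2 n, ?_⟩
  have hA := height_pos hF ω n
  have hU := fibreLikelihood_pos (φ := φ) ω n
  have hV := columnLikelihood_pos (φ := φ) ω (n + J n)
  have hlA := log_height_neg hF ω hn0
  have hlB := log_width_neg hF ω (by omega : 0 < n + J n)
  have hAB := Real.log_le_log hA (hJ1 n)
  rw [← Real.log_le_log_iff (Real.rpow_pos_of_pos hA _) (mul_pos hU hV), Real.log_rpow hA,
    Real.log_mul hU.ne' hV.ne']
  have e1 : Real.log (fibreLikelihood φ ω n) =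
      Real.log (fibreLikelihood φ ω n) / Real.log (F.height ω n) * Real.log (F.height ω n) :=
    (div_mul_cancel₀ _ hlA.ne).symm
  have e2 : Real.log (columnLikelihood φ ω (n + J n)) =
      S (n + J n) * Real.log (F.width ω (n + J n)) := (div_mul_cancel₀ _ hlB.ne).symm
  have e3 := mul_le_mul_of_nonneg_left hAB (hS0 (n + J n) (by omega))
  have e4 := mul_le_mul_of_nonpos_right
    (show Real.log (fibreLikelihood φ ω n) / Real.log (F.height ω n) + S (n + J n) ≤ α + ε by
      linarith [hDα n hn0]) hlA.le
  rw [e1, e2]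
  linarith

/-! ### Coding of the attractor and the size of approximate squares -/

lemma map_zero (i : Fin N) (x : EuclideanSpace ℝ (Fin 2)) :
    F.map i x 0 = F.b i * x 0 + F.t i 0 := by
  simp [map, linearPart, dotProduct, Fin.sum_univ_two]

lemma map_one (i : Fin N) (x : EuclideanSpace ℝ (Fin 2)) :
    F.map i x 1 = F.d i * x 0 + F.a i * x 1 + F.t i 1 := by
  simp [map, linearPart, dotProduct, Fin.sum_univ_two]

/-- `y` is an orbit in `Λ` along the symbols `ω`: the point `y 0` has the code `ω`, and `y n` is its
preimage under the `n`-th composition of the maps. -/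
structure IsOrbit (F : TriangularIFS N) (Λ : Set (EuclideanSpace ℝ (Fin 2))) (ω : ℕ → Fin N)
    (y : ℕ → EuclideanSpace ℝ (Fin 2)) : Prop where
  mem : ∀ n, y n ∈ Λ
  eq_map : ∀ n, y n = F.map (ω n) (y (n + 1))

/-- Every point of the attractor has a code: choose preimages recursively. -/
lemma IsAttractor.exists_isOrbit {Λ : Set (EuclideanSpace ℝ (Fin 2))} (hΛ : F.IsAttractor Λ)
    {x : EuclideanSpace ℝ (Fin 2)} (hx : x ∈ Λ) : ∃ ω y, IsOrbit F Λ ω y ∧ y 0 = x := by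
  have hstep : ∀ z : Λ, ∃ i, ∃ z' : Λ, (z : EuclideanSpace ℝ (Fin 2)) = F.map i z' := by
    rintro ⟨z, hz⟩
    rw [hΛ.eq_iUnion] at hz
    obtain ⟨i, z', hz', rfl⟩ := Set.mem_iUnion.1 hz
    exact ⟨i, ⟨z', hz'⟩, rfl⟩
  choose I Z hIZ using hstep
  let y : ℕ → Λ := fun n => Z^[n] ⟨x, hx⟩
  refine ⟨fun n => I (y n), fun n => y n, ⟨fun n => (y n).2, fun n => ?_⟩, rfl⟩
  have : y (n + 1) = Z (y n) := Function.iterate_succ_apply' _ _ _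
  rw [this]
  exact hIZ _

/-- The first coordinates only see the columns: codes that agree in their first `m` columns contract
the horizontal distance by exactly the width of the cylinder. -/
lemma IsOrbit.abs_sub_zero (hF : F.IsShiftedTGL φ r u) {Λ : Set (EuclideanSpace ℝ (Fin 2))}
    {ω ω' : ℕ → Fin N} {y y' : ℕ → EuclideanSpace ℝ (Fin 2)} (hy : IsOrbit F Λ ω y)
    (hy' : IsOrbit F Λ ω' y') {m : ℕ} (hω : ∀ l < m, φ (ω l) = φ (ω' l)) :
    |y 0 0 - y' 0 0| = F.width ω m * |y m 0 - y' m 0| := by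
  induction m with
  | zero => simp [width]
  | succ m ih =>
    have hb : F.b (ω m) = F.b (ω' m) := by rw [hF.b_eq, hF.b_eq, hω m (by omega)]
    have ht : F.t (ω m) 0 = F.t (ω' m) 0 := by rw [hF.t_eq, hF.t_eq, hω m (by omega)]
    rw [ih fun l hl => hω l (by omega), hy.eq_map m, hy'.eq_map m, map_zero, map_zero, ← hb, ← ht,
      width, width, Finset.prod_range_succ,
      show ∀ b s t c : ℝ, b * s + c - (b * t + c) = b * (s - t) by intros; ring, abs_mul,
      abs_of_pos (hF.b_pos _)]
    ring

/-- The shear contributes to the vertical distance at most `K` times the horizontal distance, where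
`K` is a bound for `|d i| / (b i - a i)`. -/
lemma IsOrbit.abs_sub_one (hF : F.IsShiftedTGL φ r u) {Λ : Set (EuclideanSpace ℝ (Fin 2))}
    {ω ω' : ℕ → Fin N} {y y' : ℕ → EuclideanSpace ℝ (Fin 2)} (hy : IsOrbit F Λ ω y)
    (hy' : IsOrbit F Λ ω' y') {K : ℝ} (hK : ∀ i, |F.d i| ≤ K * (F.b i - F.a i)) {n : ℕ}
    (hω : ∀ l < n, ω l = ω' l) :
    |y 0 1 - y' 0 1| ≤ F.height ω n * |y n 1 - y' n 1| +
      K * (|y 0 0 - y' 0 0| - F.height ω n * |y n 0 - y' n 0|) := by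
  induction n with
  | zero => simp [height]
  | succ n ih =>
    refine (ih fun l hl => hω l (by omega)).trans ?_
    have hA := height_pos hF ω n
    have hH : F.height ω (n + 1) = F.height ω n * F.a (ω n) := by
      rw [height, height, Finset.prod_range_succ]
    have h0 : |y n 0 - y' n 0| = F.b (ω n) * |y (n + 1) 0 - y' (n + 1) 0| := by
      rw [hy.eq_map n, hy'.eq_map n, ← hω n (by omega), map_zero, map_zero,
        show ∀ b s t c : ℝ, b * s + c - (b * t + c) = b * (s - t) by intros; ring, abs_mul,
        abs_of_pos (hF.b_pos _)]
    have h1 : |y n 1 - y' n 1| ≤ F.a (ω n) * |y (n + 1) 1 - y' (n + 1) 1| +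
        K * (F.b (ω n) - F.a (ω n)) * |y (n + 1) 0 - y' (n + 1) 0| := by
      rw [hy.eq_map n, hy'.eq_map n, ← hω n (by omega), map_one, map_one,
        show ∀ d a s t s' t' c : ℝ, d * s + a * t + c - (d * s' + a * t' + c) =
          a * (t - t') + d * (s - s') by intros; ring]
      refine (abs_add_le _ _).trans ?_
      rw [abs_mul, abs_mul, abs_of_pos (hF.a_pos _)]
      gcongr
      exact hK _
    have h2 := mul_le_mul_of_nonneg_left h1 hA.le
    rw [hH, h0]
    linarith

/-- An approximate square of level `n` has diameter comparable to the height of the cylinder. -/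
lemma exists_dist_le (hF : F.IsShiftedTGL φ r u) {Λ : Set (EuclideanSpace ℝ (Fin 2))}
    (hΛ : Bornology.IsBounded Λ) :
    ∃ C : ℝ, 0 < C ∧ ∀ (ω ω' : ℕ → Fin N) (y y' : ℕ → EuclideanSpace ℝ (Fin 2)),
      IsOrbit F Λ ω y → IsOrbit F Λ ω' y' → ∀ n j, (∀ l < n, ω l = ω' l) →
      (∀ l < n + j, φ (ω l) = φ (ω' l)) → F.width ω (n + j + 1) < F.height ω n →
      dist (y 0) (y' 0) ≤ C * F.height ω n := by
  have := hF.nonempty_fin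
  obtain ⟨i₀, hi₀⟩ := Finite.exists_min F.b
  obtain ⟨i₁, hi₁⟩ := Finite.exists_max fun i => |F.d i| / (F.b i - F.a i)
  have hba : ∀ i, 0 < F.b i - F.a i := fun i => sub_pos.2 (hF.a_lt_b i)
  set K := |F.d i₁| / (F.b i₁ - F.a i₁) with hK
  have hK0 : 0 ≤ K := div_nonneg (abs_nonneg _) (hba _).le
  have hKd : ∀ i, |F.d i| ≤ K * (F.b i - F.a i) := fun i => (div_le_iff₀ (hba i)).1 (hi₁ i)
  obtain ⟨R, hR⟩ := Metric.isBounded_iff.1 hΛ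
  have hb0 := hF.b_pos i₀
  refine ⟨(1 + K) * ((|R| + 1) / F.b i₀) + (|R| + 1), by positivity, ?_⟩
  intro ω ω' y y' hy hy' n j hω hφ hlt
  have hA := height_pos hF ω n
  have hcoord : ∀ (z z' : EuclideanSpace ℝ (Fin 2)), z ∈ Λ → z' ∈ Λ → ∀ k,
      |z k - z' k| ≤ |R| + 1 := by
    intro z z' hz hz' k
    have h1 := PiLp.norm_apply_le (z - z') k
    rw [← dist_eq_norm, Real.norm_eq_abs] at h1
    have h2 := hR hz hz'
    have h3 := le_abs_self R
    simp only [PiLp.sub_apply] at h1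
    linarith
  have hwid : F.width ω (n + j) ≤ F.height ω n / F.b i₀ := by
    rw [le_div_iff₀ hb0]
    refine le_trans ?_ hlt.le
    have : F.width ω (n + j + 1) = F.width ω (n + j) * F.b (ω (n + j)) := by
      rw [width, width, Finset.prod_range_succ]
    rw [this]
    exact mul_le_mul_of_nonneg_left (hi₀ _) (width_pos hF ω _).le
  have hx : |y 0 0 - y' 0 0| ≤ F.height ω n * ((|R| + 1) / F.b i₀) := by
    rw [hy.abs_sub_zero hF hy' hφ]
    calc _ ≤ F.height ω n / F.b i₀ * (|R| + 1) :=
          mul_le_mul hwid (hcoord _ _ (hy.mem _) (hy'.mem _) 0) (abs_nonneg _) (by positivity)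
      _ = _ := by ring
  have hv : |y 0 1 - y' 0 1| ≤ F.height ω n * (|R| + 1) + K * |y 0 0 - y' 0 0| := by
    have h1 := hy.abs_sub_one hF hy' hKd hω
    have h2 := mul_le_mul_of_nonneg_left (hcoord _ _ (hy.mem n) (hy'.mem n) 1) hA.le
    have h3 : 0 ≤ K * (F.height ω n * |y n 0 - y' n 0|) := by positivity
    linarith
  have hd : dist (y 0) (y' 0) ≤ |y 0 0 - y' 0 0| + |y 0 1 - y' 0 1| := by
    rw [EuclideanSpace.dist_eq, Fin.sum_univ_two, Real.dist_eq, Real.dist_eq]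
    refine Real.sqrt_le_iff.2 ⟨by positivity, ?_⟩
    nlinarith [abs_nonneg (y 0 0 - y' 0 0), abs_nonneg (y 0 1 - y' 0 1)]
  have h4 := mul_le_mul_of_nonneg_left hx hK0
  linarith

/-! ### The covering by approximate squares -/

/-- The points of `Λ` in the approximate square given by the word `w` of `n` symbols followed by `j`
columns that have a code for which this square is likely: its size, the height of the `n`-th cylinder, to
the power `s` is at most the product of the likelihoods. -/
def likelySquare (F : TriangularIFS N) (φ : Fin N → Fin M)
    (Λ : Set (EuclideanSpace ℝ (Fin 2))) (s : ℝ) {n j : ℕ}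
    (w : (Fin n → Fin N) × (Fin j → Fin M)) : Set (EuclideanSpace ℝ (Fin 2)) :=
  {x | ∃ ω y, IsOrbit F Λ ω y ∧ y 0 = x ∧ (∀ l : Fin n, ω l = w.1 l) ∧
    (∀ l : Fin j, φ (ω (n + l)) = w.2 l) ∧ F.height ω n ≤ F.width ω (n + j) ∧
    F.width ω (n + j + 1) < F.height ω n ∧
    F.height ω n ^ s ≤ fibreLikelihood φ ω n * columnLikelihood φ ω (n + j)}

/-- Besides the diameter bound `C * β ^ n`, the power `s + ε` of the diameter is controlled by the
type weight of the word, with a factor that decays geometrically in `n` and `j`. -/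
lemma ediam_likelySquare_le (hF : F.IsShiftedTGL φ r u) {Λ : Set (EuclideanSpace ℝ (Fin 2))}
    (hΛ : Bornology.IsBounded Λ) {β : ℝ} (hβ : ∀ i, F.b i ≤ β) :
    ∃ C : ℝ, 0 < C ∧ ∀ (s ε : ℝ), 0 < s → 0 < ε → ∀ (n j : ℕ) (_ : 0 < n)
      (w : (Fin n → Fin N) × (Fin j → Fin M)),
      Metric.ediam (likelySquare F φ Λ s w) ≤ ENNReal.ofReal (C * β ^ n) ∧
      Metric.ediam (likelySquare F φ Λ s w) ^ (s + ε) ≤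
        ENNReal.ofReal (C ^ (s + ε) * ((β ^ ε) ^ n * (β ^ ε) ^ j) * typeWeight φ w) := by
  obtain ⟨C, hC, hdist⟩ := exists_dist_le hF hΛ
  refine ⟨C, hC, fun s ε hs hε n j hn w => ?_⟩
  have hsε : 0 < s + ε := by positivity
  rcases (likelySquare F φ Λ s w).eq_empty_or_nonempty with
    h | ⟨x₀, ω₀, y₀, -, -, h1, h2, h3, h4, h5⟩
  · rw [h, Metric.ediam_empty, ENNReal.zero_rpow_of_pos hsε]
    exact ⟨zero_le, zero_le⟩
  set A := F.height ω₀ n with hA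
  have hA0 : 0 < A := height_pos hF ω₀ n
  have hβ0 : 0 ≤ β := by
    obtain ⟨i⟩ := hF.nonempty_fin
    exact (hF.b_pos i).le.trans (hβ i)
  have hdiam : Metric.ediam (likelySquare F φ Λ s w) ≤ ENNReal.ofReal (C * A) := by
    refine Metric.ediam_le ?_
    rintro x ⟨ω, y, hy, rfl, k1, k2, k3, k4, -⟩ x' ⟨ω', y', hy', rfl, k1', k2', -, -, -⟩
    have hω : ∀ l < n, ω l = ω' l := fun l hl => by rw [k1 ⟨l, hl⟩, k1' ⟨l, hl⟩]
    have hωA : F.height ω n = A := Finset.prod_congr rfl fun l hl => by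
      rw [k1 ⟨l, Finset.mem_range.1 hl⟩, h1 ⟨l, Finset.mem_range.1 hl⟩]
    rw [edist_dist, ← hωA]
    refine ENNReal.ofReal_le_ofReal (hdist ω ω' y y' hy hy' n j hω (fun l hl => ?_) k4)
    rcases lt_or_ge l n with hl' | hl'
    · rw [hω l hl']
    · obtain ⟨i, rfl⟩ := Nat.exists_eq_add_of_le hl'
      rw [k2 ⟨i, by omega⟩, k2' ⟨i, by omega⟩]
  constructor
  · refine hdiam.trans (ENNReal.ofReal_le_ofReal ?_)
    exact mul_le_mul_of_nonneg_left
      ((height_le_width hF ω₀ n).trans (width_le_pow hF hβ ω₀ n)) hC.le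
  · refine (ENNReal.rpow_le_rpow hdiam hsε.le).trans ?_
    rw [ENNReal.ofReal_rpow_of_nonneg (by positivity) hsε.le]
    refine ENNReal.ofReal_le_ofReal ?_
    rw [Real.mul_rpow hC.le hA0.le, Real.rpow_add hA0, mul_assoc, mul_comm (A ^ s)]
    have e1 : A ^ ε ≤ (β ^ ε) ^ n * (β ^ ε) ^ j := by
      rw [← pow_add, ← Real.rpow_natCast, ← Real.rpow_mul hβ0, mul_comm ε, Real.rpow_mul hβ0,
        Real.rpow_natCast]
      exact Real.rpow_le_rpow hA0.le (h3.trans (width_le_pow hF hβ ω₀ _)) hε.le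
    have e2 : A ^ s ≤ typeWeight φ w := h5.trans (likelihood_le_typeWeight hn h1 h2)
    have e3 : 0 ≤ A ^ s := Real.rpow_nonneg hA0.le s
    gcongr

lemma summable_succ_pow_mul_geometric (k : ℕ) {z : ℝ} (h0 : 0 < z) (h1 : z < 1) :
    Summable fun n : ℕ => (n + 1 : ℝ) ^ k * z ^ n := by
  have h := (summable_nat_add_iff (f := fun n : ℕ => (n : ℝ) ^ k * z ^ n) 1).2
    (summable_pow_mul_geometric_of_norm_lt_one k
      (show ‖z‖ < 1 by rwa [Real.norm_eq_abs, abs_of_pos h0]))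
  refine (h.mul_right z⁻¹).congr fun n => ?_
  push_cast
  rw [pow_succ]
  field_simp

open MeasureTheory in
/-- The likely squares of all levels beyond `n₀` cover `Λ`, and the sums of the powers of their
diameters are bounded independently of `n₀`. -/
lemma hausdorffMeasure_ne_top (hF : F.IsShiftedTGL φ r u) {Λ : Set (EuclideanSpace ℝ (Fin 2))}
    (hΛ : F.IsAttractor Λ) {α ε : ℝ} (hα0 : 0 ≤ α) (hε : 0 < ε)
    (hα : ∀ p ∈ stdSimplex ℝ (Fin N), F.D φ p ≤ α) : μH[α + ε + ε] Λ ≠ ⊤ := by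
  obtain ⟨β, hβ0, hβ1, hβ⟩ := hF.exists_b_le
  obtain ⟨C, hC, hdiam⟩ := ediam_likelySquare_le hF hΛ.isCompact.isBounded hβ
  have hs : 0 < α + ε := by positivity
  set z := β ^ ε with hz
  have hz0 : 0 < z := Real.rpow_pos_of_pos hβ0 ε
  have hz1 : z < 1 := Real.rpow_lt_one hβ0.le hβ1 hε
  set f : ℕ × ℕ → ℝ := fun p => C ^ (α + ε + ε) *
    (((p.1 + 1 : ℝ) ^ (N + M) * z ^ p.1) * ((p.2 + 1 : ℝ) ^ M * z ^ p.2)) with hf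
  have hfs : Summable f := ((summable_succ_pow_mul_geometric (N + M) hz0 hz1).mul_of_nonneg
    (summable_succ_pow_mul_geometric M hz0 hz1) (fun _ => by positivity)
    (fun _ => by positivity)).mul_left _
  let t : ∀ _ : ℕ, (Σ p : ℕ × ℕ, (Fin p.1 → Fin N) × (Fin p.2 → Fin M)) →
      Set (EuclideanSpace ℝ (Fin 2)) :=
    fun n₀ i => if n₀ < i.1.1 then likelySquare F φ Λ (α + ε) i.2 else ∅
  have hrad : Filter.Tendsto (fun n₀ : ℕ => ENNReal.ofReal (C * β ^ n₀)) Filter.atTop (nhds 0) := by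
    have := (tendsto_pow_atTop_nhds_zero_of_lt_one hβ0.le hβ1).const_mul C
    rw [mul_zero] at this
    simpa using ENNReal.tendsto_ofReal this
  have hle := Measure.hausdorffMeasure_le_liminf_tsum (α + ε + ε) Λ
    (fun n₀ : ℕ => ENNReal.ofReal (C * β ^ n₀)) hrad t ?_ ?_
  · refine ne_top_of_le_ne_top (Summable.tsum_ofReal_ne_top hfs) (hle.trans ?_)
    refine Filter.liminf_le_of_frequently_le' (Filter.Frequently.of_forall fun n₀ => ?_)
    rw [ENNReal.tsum_sigma']
    refine ENNReal.tsum_le_tsum fun ⟨n, j⟩ => ?_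
    rw [tsum_fintype]
    calc _ ≤ ∑ w : (Fin n → Fin N) × (Fin j → Fin M),
          ENNReal.ofReal (C ^ (α + ε + ε) * (z ^ n * z ^ j) * typeWeight φ w) := by
          refine Finset.sum_le_sum fun w _ => ?_
          by_cases h : n₀ < n
          · simpa only [t, if_pos h] using (hdiam (α + ε) ε hs hε n j (by omega) w).2
          · simp only [t, if_neg h, Metric.ediam_empty]
            rw [ENNReal.zero_rpow_of_pos (by positivity)]
            exact zero_le
      _ = ENNReal.ofReal (C ^ (α + ε + ε) * (z ^ n * z ^ j) *
          ∑ w : (Fin n → Fin N) × (Fin j → Fin M), typeWeight φ w) := by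
          rw [Finset.mul_sum, ENNReal.ofReal_sum_of_nonneg]
          exact fun w _ => mul_nonneg (by positivity) (typeWeight_nonneg w)
      _ ≤ ENNReal.ofReal (f (n, j)) := by
          refine ENNReal.ofReal_le_ofReal ?_
          have h1 : (n + j + 1 : ℝ) ^ M ≤ (n + 1 : ℝ) ^ M * (j + 1 : ℝ) ^ M := by
            rw [← mul_pow]
            have : 0 ≤ (n : ℝ) * j := by positivity
            gcongr
            linarith
          calc _ ≤ C ^ (α + ε + ε) * (z ^ n * z ^ j) *
                ((n + 1 : ℝ) ^ N * ((n + 1 : ℝ) ^ M * (j + 1 : ℝ) ^ M)) := by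
                refine mul_le_mul_of_nonneg_left ?_ (by positivity)
                exact (sum_typeWeight_le φ n j).trans
                  (mul_le_mul_of_nonneg_left h1 (by positivity))
            _ = f (n, j) := by simp only [hf]; ring
  · refine Filter.Eventually.of_forall fun n₀ i => ?_
    by_cases h : n₀ < i.1.1
    · simp only [t, if_pos h]
      refine (hdiam (α + ε) ε hs hε _ _ (by omega) i.2).1.trans (ENNReal.ofReal_le_ofReal ?_)
      exact mul_le_mul_of_nonneg_left (pow_le_pow_of_le_one hβ0.le hβ1.le h.le) hC.le
    · simp only [t, if_neg h, Metric.ediam_empty]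
      exact zero_le
  · refine Filter.Eventually.of_forall fun n₀ x hx => ?_
    obtain ⟨ω, y, hy, hyx⟩ := hΛ.exists_isOrbit hx
    obtain ⟨n, j, hn, h1, h2, h3⟩ := exists_height_rpow_le hF hε hα ω n₀
    refine Set.mem_iUnion.2 ⟨⟨(n, j), fun l => ω l, fun l => φ (ω (n + l))⟩, ?_⟩
    simp only [t, if_pos hn]
    exact ⟨ω, y, hy, hyx, fun _ => rfl, fun _ => rfl, h1, h2, h3⟩

lemma IsShiftedTGL.D_le_alphaStar (hF : F.IsShiftedTGL φ r u) {p : Fin N → ℝ}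
    (hp : p ∈ stdSimplex ℝ (Fin N)) : F.D φ p ≤ F.alphaStar φ :=
  le_csSup hF.bddAbove_D ⟨p, hp, rfl⟩

lemma IsShiftedTGL.alphaStar_nonneg (hF : F.IsShiftedTGL φ r u) : 0 ≤ F.alphaStar φ := by
  obtain ⟨i⟩ := hF.nonempty_fin
  refine le_trans ?_ (hF.D_le_alphaStar (freq_mem_stdSimplex (fun _ => i) one_pos))
  rw [D_freq hF _ one_pos]
  exact add_nonneg
    (div_nonneg_of_nonpos (Real.log_nonpos (fibreLikelihood_pos _ _).le
      (fibreLikelihood_le_one _ _)) (log_height_neg hF _ one_pos).le)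
    (div_nonneg_of_nonpos (Real.log_nonpos (columnLikelihood_pos _ _).le
      (columnLikelihood_le_one _ _)) (log_width_neg hF _ one_pos).le)

lemma dimH_le_alphaStar (hF : F.IsShiftedTGL φ r u) {Λ : Set (EuclideanSpace ℝ (Fin 2))}
    (hΛ : F.IsAttractor Λ) : dimH Λ ≤ ENNReal.ofReal (F.alphaStar φ) := by
  refine ENNReal.le_of_forall_pos_le_add fun δ hδ _ => ?_
  have h := hausdorffMeasure_ne_top hF hΛ hF.alphaStar_nonneg
    (half_pos (NNReal.coe_pos.2 hδ)) fun p hp => hF.D_le_alphaStar hp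
  rw [add_assoc, add_halves, ← Real.coe_toNNReal _ hF.alphaStar_nonneg, ← NNReal.coe_add] at h
  simpa [ENNReal.ofReal] using dimH_le_of_hausdorffMeasure_ne_top h

end TriangularIFS

end TGL

theorem theorem3p1 {N M : ℕ} (F : TGL.TriangularIFS N) (φ : Fin N → Fin M) (r u : Fin M → ℝ)
    (hF : F.IsShiftedTGL φ r u) (Λ : Set (EuclideanSpace ℝ (Fin 2))) (hΛ : F.IsAttractor Λ) :
    ((dimH Λ : ENNReal) : EReal) ≤ ((F.alphaStar φ : ℝ) : EReal) ∧
      BddAbove (F.D φ '' stdSimplex ℝ (Fin N)) ∧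
      ∃ p ∈ stdSimplex ℝ (Fin N), (∀ i, 0 < p i) ∧ F.D φ p = F.alphaStar φ := by
  refine ⟨?_, hF.bddAbove_D, ?_⟩
  · have h := EReal.coe_ennreal_le_coe_ennreal_iff.2 (TGL.TriangularIFS.dimH_le_alphaStar hF hΛ)
    rwa [EReal.coe_ennreal_ofReal, max_eq_left hF.alphaStar_nonneg] at h
  · obtain ⟨p, hp, hmax⟩ := hF.exists_isMaxOn_D
    refine ⟨p, hp, hF.pos_of_isMaxOn_D hp hmax, le_antisymm (hF.D_le_alphaStar hp) ?_⟩
    exact csSup_le ⟨_, p, hp, rfl⟩ (by rintro _ ⟨q, hq, rfl⟩; exact hmax hq)
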